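/- Let $k\ge 1$ and let $\Lambda$ be a $k$-graph, i.e. a small category with range and source maps $r,s$ to its vertex set $\Lambda^0$ and a degree functor $d:\Lambda\to\mathbb{N}^k$ with the factorisation property: whenever $d(\lambda)=m+n$ there are unique $\mu,\nu\in\Lambda$ with $d(\mu)=m$, $d(\nu)=n$ and $\lambda=\mu\nu$. Suppose that $\Lambda$ is finite, i.e. $\Lambda^n:=d^{-1}(n)$ is finite for every $n\in\mathbb{N}^k$. Let $A_i$ ($1\le i\le k$) be the $\Lambda^0\times\Lambda^0$ vertex matrix whose entry $A_i(v,w)$ is the number of paths of degree $e_i$ with range $v$ and source $w$, and let $\rho(A_i)$ be its spectral radius. Suppose that $\Lambda$ is coordinatewise irreducible: for all $i$ and all $v,w\in\Lambda^0$ there is $n\in\mathbb{N}=\{0,1,2,\dots\}$ with $A_i^n(v,w)\neq 0$. Put $\ln\rho(\Lambda):=(\ln\rho(A_1),\dots,\ln\rho(A_k))$, where $\ln 0=-\infty$. For $n\in(\mathbb{N}\cup\{\infty\})^k$ let $\Omega_{k,n}$ be the $k$-graph whose morphisms are the pairs $(p,q)\in\mathbb{N}^k\times\mathbb{N}^k$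 with $p\le q\le n$, where $(p,q)$ has range $p$, source $q$ and degree $q-p$. Let $\Lambda^n$ denote the set of degree-preserving functors $x:\Omega_{k,n}\to\Lambda$ (for $n\in\mathbb{N}^k$ this is identified with $d^{-1}(n)$), write $d(x)=n$ for $x\in\Lambda^n$, and let $W_\Lambda:=\bigcup_{n\in(\mathbb{N}\cup\{\infty\})^k}\Lambda^n$ and $\Lambda^\infty:=\Lambda^{(\infty,\dots,\infty)}$. For $\lambda\in\Lambda$ let $Z(\lambda)=\{x\in W_\Lambda: d(\lambda)\le d(x),\ x(0,d(\lambda))=\lambda\}$, and give $W_\Lambda$ the topology generated by the sets $Z(\lambda\setminus G):=Z(\lambda)\setminus\bigcup_{\alpha\in G}Z(\lambda\alpha)$, where $G$ is a finite subset of $s(\lambda)\Lambda=\{\alpha\in\Lambda: r(\alpha)=s(\lambda)\}$. For $p\in\mathbb{N}^k$ with $p\le d(x)$ let $\sigma^p(x)\in\Lambda^{d(x)-p}$ be the shift, $\sigma^p(x)(q,q')=x(q+p,q'+p)$. Let $$\mathcal{G}=\{(x,p-q,y): x,y\in W_\Lambda,\ p,q\in\mathbb{N}^k,\ p\le d(x),\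 q\le d(y),\ \sigma^p(x)=\sigma^q(y)\}$$ be the path groupoid, with range $x$ and source $y$ for $(x,n,y)$, and unit space $\mathcal{G}^{(0)}=W_\Lambda$. For $s(\lambda)=s(\eta)$ put $Z(\lambda*\eta)=\{(x,d(\lambda)-d(\eta),y)\in\mathcal{G}: x\in Z(\lambda),\ y\in Z(\eta),\ \sigma^{d(\lambda)}(x)=\sigma^{d(\eta)}(y)\}$, and give $\mathcal{G}$ the topology generated by the sets $Z(\lambda*\eta)\setminus\bigcup_{\tau\in G}Z(\lambda\tau*\eta\tau)$ with $G\subseteq s(\lambda)\Lambda$ finite. Let $r\in(0,\infty)^k$ and let $c:\mathcal{G}\to\mathbb{R}$ be the cocycle $c(x,n,y)=r\cdot n$. Let $\mu$ be a Borel probability measure on $W_\Lambda$ that is quasi-invariant with Radon--Nikodym cocycle $e^{-c}$; that is, for every Borel function $f:\mathcal{G}\to[0,\infty]$, $$\int_{W_\Lambda}\sum_{g\in\mathcal{G},\,r(g)=x} f(g)\,d\mu(x)=\int_{W_\Lambda}\sum_{g\in\mathcal{G},\,s(g)=y}e^{-c(g)}f(g)\,d\mu(y).$$ Then: 1. $r\ge\ln\rho(\Lambda)$,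 i.e. $r_i\ge\ln\rho(A_i)$ for $1\le i\le k$. 2. For each $l\in\{1,\dots,k\}$, if $\mu\big(\bigcup_{\{n:\,n_l=\infty\}}\Lambda^n\big)\neq0$, then $r_l=\ln\rho(A_l)$. In particular, if $\mu(\Lambda^\infty)\neq0$, then $r=\ln\rho(\Lambda)$. -/

import Mathlib

open CategoryTheory MeasureTheory
open scoped ENNReal

universe u₁ u₂

/-- A `k`-graph `Λ` with vertex set `V`: a small category with a degree functor to `ℕ^k` that has
the unique factorisation property. A morphism `l : v ⟶ w` stands for a path with *range* `v` and
*source* `w`, so that `v ⟶ w` is the set `vΛw`, and the composite of paths `λμ`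
(where `s(λ) = r(μ)`) is `λ ≫ μ`. -/
structure KGraph (k : ℕ) (V : Type u₁) [Category.{u₂} V] where
  /-- the degree of a path -/
  deg : ∀ {v w : V}, (v ⟶ w) → (Fin k → ℕ)
  deg_id : ∀ v : V, deg (𝟙 v) = 0
  deg_comp : ∀ {v w z : V} (l : v ⟶ w) (m : w ⟶ z), deg (l ≫ m) = deg l + deg m
  factorization : ∀ {v w : V} (l : v ⟶ w) (m n : Fin k → ℕ), deg l = m + n →
    ∃! t : Σ z : V, (v ⟶ z) × (z ⟶ w),
      deg t.2.1 = m ∧ deg t.2.2 = n ∧ t.2.1 ≫ t.2.2 = l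

namespace KGraph

variable {k : ℕ} {V : Type u₁} [Category.{u₂} V] (Λ : KGraph k V)

/-- `Λ` is finite: the set `Λ^n` of all paths of degree `n` is finite, for every `n ∈ ℕ^k`.
(For `n = 0` this says that there are finitely many vertices.) -/
def IsFinite : Prop :=
  ∀ n : Fin k → ℕ, {l : Σ v w : V, (v ⟶ w) | Λ.deg l.2.2 = n}.Finite

/-- The vertex matrix `A_i`, with entries `A_i(v, w) = |vΛ^{e_i}w|`. -/
noncomputable def vertexMatrix (i : Fin k) : Matrix V V ℕ :=
  Matrix.of fun v w => Nat.card {l : v ⟶ w // Λ.deg l = Pi.single i 1}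

/-- Every vertex matrix `A_i` is irreducible: for all `v, w` some power of `A_i` has a nonzero
`(v, w)` entry. -/
def CoordinatewiseIrreducible [Fintype V] [DecidableEq V] : Prop :=
  ∀ (i : Fin k) (v w : V), ∃ n : ℕ, (Λ.vertexMatrix i ^ n) v w ≠ 0

/-- The spectral radius `ρ(A_i)` of the vertex matrix `A_i`, regarded as a complex matrix. -/
noncomputable def rho [Fintype V] [DecidableEq V] (i : Fin k) : ℝ≥0∞ :=
  spectralRadius ℂ ((Λ.vertexMatrix i).map (fun a : ℕ => (a : ℂ)))

/-- The objects of the `k`-graph `Ω_{k,n}`, where `n ∈ (ℕ ∪ {∞})^k`. Its morphisms are the pairs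
`(p, q)` with `p ≤ q ≤ n`, that is, those of the category that the order defines;
`(p, q)` has degree `q - p`. -/
abbrev Omega {k : ℕ} (n : Fin k → ℕ∞) : Type :=
  {p : Fin k → ℕ // ∀ i, (p i : ℕ∞) ≤ n i}

/-- The path space `W_Λ`, the disjoint union over `n ∈ (ℕ ∪ {∞})^k` of the sets `Λ^n` of
`k`-graph morphisms (degree-preserving functors) `x : Ω_{k,n} → Λ`. -/
structure PathSpace where
  /-- the degree `d(x)` -/
  d : Fin k → ℕ∞
  /-- the functor `x : Ω_{k,d(x)} → Λ` -/
  toFunctor : Omega d ⥤ V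
  deg_map : ∀ {p q : Omega d} (f : p ⟶ q), Λ.deg (toFunctor.map f) = q.1 - p.1

variable {Λ}

/-- The finite path `x(p, q)` for `p ≤ q ≤ d(x)`, together with its range and source. -/
def PathSpace.segment (x : Λ.PathSpace) (p q : Omega x.d) (h : p ≤ q) : Σ v w : V, (v ⟶ w) :=
  ⟨x.toFunctor.obj p, x.toFunctor.obj q, x.toFunctor.map (homOfLE h)⟩

/-- `0` as an object of `Ω_{k,n}`. -/
def Omega.zero (n : Fin k → ℕ∞) : Omega n := ⟨0, fun i => by simp⟩

theorem Omega.zero_le {n : Fin k → ℕ∞} (p : Omega n) : Omega.zero n ≤ p :=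
  fun i => Nat.zero_le (p.1 i)

/-- The translation `q ↦ q + p` from `Ω_{k,n-p}` to `Ω_{k,n}`, for `p ≤ n` (with `∞ - p = ∞`). -/
def Omega.translate {n : Fin k → ℕ∞} (p : Omega n) (q : Omega (fun i => n i - (p.1 i : ℕ∞))) :
    Omega n :=
  ⟨q.1 + p.1, fun i => by
    have h := add_le_add_left (q.2 i) (p.1 i : ℕ∞)
    rw [tsub_add_cancel_of_le (p.2 i)] at h
    simpa using h⟩

theorem Omega.translate_mono {n : Fin k → ℕ∞} (p : Omega n) : Monotone (Omega.translate p) :=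
  fun _ _ h i => Nat.add_le_add_right (h i) (p.1 i)

/-- The shift `σ^p(x) ∈ Λ^{d(x)-p}` for `p ≤ d(x)`, given by
`σ^p(x)(q, q') = x(q + p, q' + p)`. -/
def PathSpace.shift (x : Λ.PathSpace) (p : Omega x.d) : Λ.PathSpace where
  d := fun i => x.d i - (p.1 i : ℕ∞)
  toFunctor := (Omega.translate_mono p).functor ⋙ x.toFunctor
  deg_map := by
    intro q q' f
    rw [Functor.comp_map, x.deg_map]
    funext i
    exact Nat.add_sub_add_right (q'.1 i) (p.1 i) (q.1 i)

variable (Λ)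

/-- The cylinder set `Z(λ) = {x ∈ W_Λ : x(0, d(λ)) = λ}`. -/
def cylinder {v w : V} (l : v ⟶ w) : Set Λ.PathSpace :=
  {x | ∃ h : ∀ i, (Λ.deg l i : ℕ∞) ≤ x.d i,
    x.segment (Omega.zero x.d) ⟨Λ.deg l, h⟩ (Omega.zero_le _) = ⟨v, w, l⟩}

/-- The set `Z(λ ∖ G) = Z(λ) ∖ ⋃_{α ∈ G} Z(λα)`, for a finite set `G ⊆ s(λ)Λ`. -/
def cylinderDiff {v w : V} (l : v ⟶ w) (G : Finset (Σ z : V, (w ⟶ z))) : Set Λ.PathSpace :=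
  Λ.cylinder l \ ⋃ a ∈ G, Λ.cylinder (l ≫ a.2)

/-- The topology on `W_Λ`, generated by the sets `Z(λ ∖ G)`. -/
instance : TopologicalSpace Λ.PathSpace :=
  TopologicalSpace.generateFrom
    {S | ∃ (v w : V) (l : v ⟶ w) (G : Finset (Σ z : V, (w ⟶ z))), S = Λ.cylinderDiff l G}

/-- `W_Λ` carries its Borel σ-algebra. -/
instance : MeasurableSpace Λ.PathSpace := borel _

instance : BorelSpace Λ.PathSpace := ⟨rfl⟩

/-- The path groupoid `𝒢` of `Λ`: the triples `(x, p - q, y)` with `x, y ∈ W_Λ`, `p ≤ d(x)`,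
`q ≤ d(y)` and `σ^p(x) = σ^q(y)`. Its unit space is `W_Λ`. -/
structure PathGroupoid where
  /-- the range of the groupoid element `(x, n, y)`, which is `x` -/
  range : Λ.PathSpace
  /-- the middle entry `n ∈ ℤ^k` of the groupoid element `(x, n, y)` -/
  lag : Fin k → ℤ
  /-- the source of the groupoid element `(x, n, y)`, which is `y` -/
  source : Λ.PathSpace
  exists_shift : ∃ (p : Omega range.d) (q : Omega source.d),
    (∀ i, lag i = (p.1 i : ℤ) - (q.1 i : ℤ)) ∧ range.shift p = source.shift q

/-- The set `Z(λ * η)` for `s(λ) = s(η)`: all `(x, d(λ) - d(η), y)` with `x ∈ Z(λ)`,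
`y ∈ Z(η)` and `σ^{d(λ)}(x) = σ^{d(η)}(y)`. -/
def bisection {v v' w : V} (l : v ⟶ w) (e : v' ⟶ w) : Set Λ.PathGroupoid :=
  {g | (∀ i, g.lag i = (Λ.deg l i : ℤ) - (Λ.deg e i : ℤ)) ∧
    g.range ∈ Λ.cylinder l ∧ g.source ∈ Λ.cylinder e ∧
    ∃ (hp : ∀ i, (Λ.deg l i : ℕ∞) ≤ g.range.d i) (hq : ∀ i, (Λ.deg e i : ℕ∞) ≤ g.source.d i),
      g.range.shift ⟨Λ.deg l, hp⟩ = g.source.shift ⟨Λ.deg e, hq⟩}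

/-- The set `Z(λ * η ∖ G) = Z(λ * η) ∖ ⋃_{τ ∈ G} Z(λτ * ητ)`, for a finite set
`G ⊆ s(λ)Λ`. -/
def bisectionDiff {v v' w : V} (l : v ⟶ w) (e : v' ⟶ w) (G : Finset (Σ z : V, (w ⟶ z))) :
    Set Λ.PathGroupoid :=
  Λ.bisection l e \ ⋃ t ∈ G, Λ.bisection (l ≫ t.2) (e ≫ t.2)

/-- The topology on `𝒢`, generated by the sets `Z(λ * η ∖ G)`. -/
instance : TopologicalSpace Λ.PathGroupoid :=
  TopologicalSpace.generateFrom
    {S | ∃ (v v' w : V) (l : v ⟶ w) (e : v' ⟶ w) (G : Finset (Σ z : V, (w ⟶ z))),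
      S = Λ.bisectionDiff l e G}

/-- `𝒢` carries its Borel σ-algebra. -/
instance : MeasurableSpace Λ.PathGroupoid := borel _

instance : BorelSpace Λ.PathGroupoid := ⟨rfl⟩

/-- The cocycle `c(x, n, y) = r · n` on `𝒢`. -/
def cocycle (r : Fin k → ℝ) (g : Λ.PathGroupoid) : ℝ :=
  ∑ i, r i * (g.lag i : ℝ)

/-- The measure `μ` on the unit space `W_Λ` of the étale groupoid `𝒢` is quasi-invariant with
Radon–Nikodym cocycle `e^{-c}`. That is, let `μ_r` and `μ_s` be the Borel measures on `𝒢` with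
`∫ f dμ_r = ∫ ∑_{r(g) = x} f(g) dμ(x)` and `∫ f dμ_s = ∫ ∑_{s(g) = y} f(g) dμ(y)` for Borel
`f ≥ 0`; then `dμ_r / dμ_s = e^{-c}`. As `e^{-c}` is positive, `μ_r` and `μ_s` are then
equivalent measures. -/
def IsQuasiInvariant (μ : Measure Λ.PathSpace) (c : Λ.PathGroupoid → ℝ) : Prop :=
  ∀ f : Λ.PathGroupoid → ℝ≥0∞, Measurable f →
    ∫⁻ x, ∑' g : {g : Λ.PathGroupoid // g.range = x}, f g.1 ∂μ =
      ∫⁻ y, ∑' g : {g : Λ.PathGroupoid // g.source = y},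
        ENNReal.ofReal (Real.exp (-c g.1)) * f g.1 ∂μ

end KGraph

namespace KGraph

/-! Let S be a shift-invariant set of paths and put m_v = μ(Z(v) ∩ S). Testing quasi-invariance on
the indicator of the bisection Z(λ * s(λ)), cut down to ranges in S, gives μ(Z(λ) ∩ S) = e^{-r·d(λ)}
m_{s(λ)} (`measure_cylinder_inter`). The cylinders of the edges λ of degree e_i with range v are
disjoint, so summing yields (A_i m)_v = e^{r_i} μ(⋃ Z(λ) ∩ S) (`measure_iUnion_edge`), and this
union lies in Z(v) ∩ S.

For S = W_Λ this says A_i m ≤ e^{r_i} m. Irreducibility makes m strictly positive, and a strictly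
positive subinvariant vector bounds the spectral radius: ρ(A_i) ≤ e^{r_i}. For S = {x : d(x)_l = ∞}
every path in Z(v) ∩ S begins with an edge of degree e_l, so equality holds; if μ(S) ≠ 0, then m is
an eigenvector and e^{r_l} ≤ ρ(A_l).

The measure identity rests on the bijection x ↦ σ^{d(λ)}(x) from Z(λ) to Z(s(λ)), with inverse y ↦
λy. Paths are bundled with their endpoints, and composition is a relation, so that paths whose
endpoints agree only propositionally can be compared without casts. -/

/-- The paths of a category, bundled with their range and source. -/
abbrev Path (V : Type u₁) [Category.{u₂} V] := Σ v w : V, (v ⟶ w)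

/-! ### Finite paths: composition, prefixes and unique factorisation. -/

section Path

variable {k : ℕ} {V : Type u₁} [Category.{u₂} V]

/-- The degree of a bundled path. -/
def pathDeg (Λ : KGraph k V) (a : Path V) : Fin k → ℕ := Λ.deg a.2.2

/-- `IsComp a b c` says that the bundled paths `a` and `b` are composable with composite `c`. -/
def IsComp (a b c : Path V) : Prop :=
  ∃ (v w z : V) (f : v ⟶ w) (g : w ⟶ z), a = ⟨v, w, f⟩ ∧ b = ⟨w, z, g⟩ ∧ c = ⟨v, z, f ≫ g⟩

/-- `IsPrefix a c` says that the path `c` begins with `a`. -/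
def IsPrefix (a c : Path V) : Prop := ∃ b, IsComp a b c

theorem IsComp.mk {v w z : V} (f : v ⟶ w) (g : w ⟶ z) :
    IsComp (⟨v, w, f⟩ : Path V) ⟨w, z, g⟩ ⟨v, z, f ≫ g⟩ :=
  ⟨v, w, z, f, g, rfl, rfl, rfl⟩

theorem exists_isComp_of_eq {a b : Path V} (h : a.2.1 = b.1) : ∃ c, IsComp a b c := by
  obtain ⟨v, w, f⟩ := a
  obtain ⟨w', z, g⟩ := b
  obtain rfl : w = w' := h
  exact ⟨_, IsComp.mk f g⟩

theorem IsComp.eq {a b c c' : Path V} (h : IsComp a b c) (h' : IsComp a b c') : c = c' := by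
  obtain ⟨v, w, z, f, g, rfl, rfl, rfl⟩ := h
  obtain ⟨v', w', z', f', g', h₁, h₂, rfl⟩ := h'
  cases h₁
  cases h₂
  rfl

theorem IsComp.assoc {a b c d e : Path V} (h : IsComp a b c) (h' : IsComp c d e) :
    ∃ f, IsComp b d f ∧ IsComp a f e := by
  obtain ⟨v, w, z, f, g, rfl, rfl, rfl⟩ := h
  obtain ⟨v', w', z', f', g', h₁, rfl, rfl⟩ := h'
  cases h₁
  exact ⟨_, IsComp.mk g g', by simpa using IsComp.mk f (g ≫ g')⟩

theorem IsComp.assoc_symm {a b d e f : Path V} (h : IsComp a f e) (h' : IsComp b d f) :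
    ∃ c, IsComp a b c ∧ IsComp c d e := by
  obtain ⟨v, w, z, f, g, rfl, rfl, rfl⟩ := h'
  obtain ⟨v', w', z', f', g', rfl, h₂, rfl⟩ := h
  cases h₂
  exact ⟨_, IsComp.mk f' f, by simpa using IsComp.mk (f' ≫ f) g⟩

theorem IsComp.exists_hom {a b c : Path V} (h : IsComp a b c) :
    ∃ m : a.2.1 ⟶ c.2.1, b = ⟨_, _, m⟩ := by
  obtain ⟨v, w, z, f, g, rfl, rfl, rfl⟩ := h
  exact ⟨g, rfl⟩

theorem isComp_id_left (a : Path V) : IsComp ⟨a.1, a.1, 𝟙 a.1⟩ a a := by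
  obtain ⟨v, w, f⟩ := a
  simpa using IsComp.mk (𝟙 v) f

theorem isComp_id_right (a : Path V) : IsComp a ⟨a.2.1, a.2.1, 𝟙 a.2.1⟩ a := by
  obtain ⟨v, w, f⟩ := a
  simpa using IsComp.mk f (𝟙 w)

theorem IsComp.isPrefix {a b c : Path V} (h : IsComp a b c) : IsPrefix a c := ⟨b, h⟩

theorem IsPrefix.trans {a b c : Path V} (h : IsPrefix a b) (h' : IsPrefix b c) :
    IsPrefix a c := by
  obtain ⟨d, hd⟩ := h
  obtain ⟨e, he⟩ := h'
  obtain ⟨f, -, hf⟩ := hd.assoc he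
  exact ⟨f, hf⟩

variable (Λ : KGraph k V)

theorem IsComp.deg_eq {a b c : Path V} (h : IsComp a b c) :
    Λ.pathDeg c = Λ.pathDeg a + Λ.pathDeg b := by
  obtain ⟨v, w, z, f, g, rfl, rfl, rfl⟩ := h
  exact Λ.deg_comp f g

theorem exists_isComp (c : Path V) (m n : Fin k → ℕ) (h : Λ.pathDeg c = m + n) :
    ∃ a b, IsComp a b c ∧ Λ.pathDeg a = m ∧ Λ.pathDeg b = n := by
  obtain ⟨v, w, f⟩ := c
  obtain ⟨⟨z, f', g'⟩, ⟨h₁, h₂, h₃⟩, -⟩ := Λ.factorization f m n h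
  subst h₃
  exact ⟨_, _, IsComp.mk f' g', h₁, h₂⟩

theorem IsComp.unique {a b a' b' c : Path V} (h : IsComp a b c) (h' : IsComp a' b' c)
    (hd : Λ.pathDeg a = Λ.pathDeg a') : a = a' ∧ b = b' := by
  have hb : Λ.pathDeg b = Λ.pathDeg b' := by
    have h₁ := h.deg_eq Λ
    rw [h'.deg_eq Λ, hd] at h₁
    exact (add_left_cancel h₁).symm
  obtain ⟨v, w, z, f, g, rfl, rfl, rfl⟩ := h
  obtain ⟨v', w', z', f', g', rfl, rfl, h₃⟩ := h'
  obtain ⟨rfl, h₃⟩ := Sigma.mk.inj_iff.1 h₃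
  obtain ⟨rfl, h₃⟩ := Sigma.mk.inj_iff.1 (eq_of_heq h₃)
  have h₃ := eq_of_heq h₃
  have := (Λ.factorization (f ≫ g) _ _ (Λ.deg_comp f g)).unique
    (y₁ := ⟨w, f, g⟩) (y₂ := ⟨w', f', g'⟩) ⟨rfl, rfl, rfl⟩ ⟨hd.symm, hb.symm, h₃.symm⟩
  cases this
  exact ⟨rfl, rfl⟩

theorem IsPrefix.eq {a a' c : Path V} (h : IsPrefix a c) (h' : IsPrefix a' c)
    (hd : Λ.pathDeg a = Λ.pathDeg a') : a = a' := by
  obtain ⟨b, hb⟩ := h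
  obtain ⟨b', hb'⟩ := h'
  exact (hb.unique Λ hb' hd).1

/-- Cutting `a'` at the degree of `a` produces a prefix of `c` of that degree, which must be `a` by
unique factorisation. -/
theorem IsPrefix.of_le {a a' c : Path V} (h : IsPrefix a c) (h' : IsPrefix a' c)
    (hd : Λ.pathDeg a ≤ Λ.pathDeg a') : IsPrefix a a' := by
  obtain ⟨a'', e, he, hd', -⟩ := Λ.exists_isComp a' _ _ (add_tsub_cancel_of_le hd).symm
  rw [h.eq Λ (he.isPrefix.trans h') hd'.symm]
  exact he.isPrefix

theorem IsComp.right_eq_of_deg_left {a b c : Path V} (h : IsComp a b c)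
    (hd : Λ.pathDeg a = 0) : b = c :=
  (h.unique Λ (isComp_id_left c) (hd.trans (Λ.deg_id _).symm)).2

end Path

/-! ### The path space: initial segments, shifts and concatenation. -/

namespace PathSpace

variable {k : ℕ} {V : Type u₁} [Category.{u₂} V] {Λ : KGraph k V}

/-- The initial segment `x(0, p)`. -/
def initSeg (x : Λ.PathSpace) (p : Fin k → ℕ) (h : ∀ i, (p i : ℕ∞) ≤ x.d i) : Path V :=
  x.segment (Omega.zero x.d) ⟨p, h⟩ (Omega.zero_le _)

theorem init_congr {x y : Λ.PathSpace} {p q : Fin k → ℕ} (h : x = y) (hpq : p = q)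
    (hp : ∀ i, (p i : ℕ∞) ≤ x.d i) (hq : ∀ i, (q i : ℕ∞) ≤ y.d i) :
    x.initSeg p hp = y.initSeg q hq := by
  subst h hpq
  rfl

theorem isComp_segment (x : Λ.PathSpace) (p q s : Omega x.d) (h : p ≤ q) (h' : q ≤ s) :
    IsComp (x.segment p q h) (x.segment q s h') (x.segment p s (h.trans h')) := by
  have := IsComp.mk (x.toFunctor.map (homOfLE h)) (x.toFunctor.map (homOfLE h'))
  rwa [← x.toFunctor.map_comp] at this

theorem pathDeg_init (x : Λ.PathSpace) (p : Fin k → ℕ) (h : ∀ i, (p i : ℕ∞) ≤ x.d i) :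
    Λ.pathDeg (x.initSeg p h) = p :=
  (x.deg_map _).trans (tsub_zero p)

theorem isPrefix_init (x : Λ.PathSpace) {p q : Fin k → ℕ} (hp : ∀ i, (p i : ℕ∞) ≤ x.d i)
    (hq : ∀ i, (q i : ℕ∞) ≤ x.d i) (h : p ≤ q) : IsPrefix (x.initSeg p hp) (x.initSeg q hq) :=
  (x.isComp_segment (Omega.zero x.d) ⟨p, hp⟩ ⟨q, hq⟩ (Omega.zero_le _) h).isPrefix

/-- A segment x(p, q) is recovered from x(0, p) and x(0, q) by left cancellation, so initial
segments determine the whole functor. -/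
theorem ext_init {x y : Λ.PathSpace} (hd : x.d = y.d)
    (h : ∀ p hx hy, x.initSeg p hx = y.initSeg p hy) : x = y := by
  have hseg : ∀ (p q : Fin k → ℕ) (hx : ∀ i, (p i : ℕ∞) ≤ x.d i) (hy : ∀ i, (p i : ℕ∞) ≤ y.d i)
      (hx' : ∀ i, (q i : ℕ∞) ≤ x.d i) (hy' : ∀ i, (q i : ℕ∞) ≤ y.d i) (hpq : p ≤ q),
      x.segment ⟨p, hx⟩ ⟨q, hx'⟩ hpq = y.segment ⟨p, hy⟩ ⟨q, hy'⟩ hpq := by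
    intro p q hx hy hx' hy' hpq
    have h₁ := x.isComp_segment (Omega.zero x.d) ⟨p, hx⟩ ⟨q, hx'⟩ (Omega.zero_le _) hpq
    have h₂ := y.isComp_segment (Omega.zero y.d) ⟨p, hy⟩ ⟨q, hy'⟩ (Omega.zero_le _) hpq
    change IsComp (x.initSeg p hx) _ (x.initSeg q hx') at h₁
    change IsComp (y.initSeg p hy) _ (y.initSeg q hy') at h₂
    rw [h p hx hy, h q hx' hy'] at h₁
    exact (h₁.unique Λ h₂ rfl).2
  clear h
  obtain ⟨d, F, hF⟩ := x
  obtain ⟨d', F', hF'⟩ := y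
  obtain rfl : d = d' := hd
  have : F = F' := by
    refine Functor.hext (fun p => ?_) (fun p q f => ?_)
    · exact congrArg Sigma.fst (hseg p.1 p.1 p.2 p.2 p.2 p.2 le_rfl)
    · have := hseg p.1 q.1 p.2 p.2 q.2 q.2 (leOfHom f)
      have h₄ : ∀ {a b a' b' : V} {f : a ⟶ b} {g : a' ⟶ b'},
          (⟨a, b, f⟩ : Path V) = ⟨a', b', g⟩ → HEq f g := by
        rintro _ _ _ _ _ _ ⟨⟩
        rfl
      exact h₄ this
  subst this
  rfl

theorem segment_congr (x : Λ.PathSpace) {p q p' q' : Omega x.d} {h : p ≤ q} {h' : p' ≤ q'}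
    (hp : p.1 = p'.1) (hq : q.1 = q'.1) : x.segment p q h = x.segment p' q' h' := by
  obtain rfl := Subtype.ext hp
  obtain rfl := Subtype.ext hq
  rfl

theorem le_d_add {x : Λ.PathSpace} {p : Omega x.d} {q : Fin k → ℕ}
    (hq : ∀ i, (q i : ℕ∞) ≤ (x.shift p).d i) (i : Fin k) :
    (((q + p.1) i : ℕ) : ℕ∞) ≤ x.d i :=
  (Omega.translate p ⟨q, hq⟩).2 i

/-- `x(0, q + p)` is the composite of `x(0, p)` and `σ^p(x)(0, q)`. -/
theorem isComp_init_shift (x : Λ.PathSpace) (p : Omega x.d) (q : Fin k → ℕ)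
    (hq : ∀ i, (q i : ℕ∞) ≤ (x.shift p).d i) :
    IsComp (x.initSeg p.1 p.2) ((x.shift p).initSeg q hq) (x.initSeg (q + p.1) (le_d_add hq)) := by
  have h₁ := x.isComp_segment (Omega.zero x.d) p (Omega.translate p ⟨q, hq⟩) (Omega.zero_le _)
    (fun i => Nat.le_add_left _ _)
  have h₂ : (x.shift p).initSeg q hq = x.segment p (Omega.translate p ⟨q, hq⟩)
      (fun i => Nat.le_add_left _ _) :=
    x.segment_congr (p := Omega.translate p (Omega.zero _)) (zero_add p.1) rfl
  rw [h₂]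
  exact h₁

theorem shift_shift (x : Λ.PathSpace) (p : Omega x.d) (q : Omega (x.shift p).d) :
    (x.shift p).shift q = x.shift (Omega.translate p q) := by
  refine ext_init ?_ fun s hs hs' => ?_
  · funext i
    change x.d i - (p.1 i : ℕ∞) - (q.1 i : ℕ∞) = x.d i - ((q.1 i + p.1 i : ℕ) : ℕ∞)
    rw [tsub_tsub, Nat.cast_add, add_comm]
  · exact x.segment_congr (p := Omega.translate p (Omega.translate q (Omega.zero _)))
      (q := Omega.translate p (Omega.translate q ⟨s, hs⟩))
      (p' := Omega.translate (Omega.translate p q) (Omega.zero _))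
      (q' := Omega.translate (Omega.translate p q) ⟨s, hs'⟩)
      (add_assoc _ _ _) (add_assoc _ _ _)

theorem shift_eq_self (x : Λ.PathSpace) (p : Omega x.d) (hp : p.1 = 0) : x.shift p = x := by
  refine ext_init ?_ fun s hs hs' => ?_
  · funext i
    change x.d i - (p.1 i : ℕ∞) = x.d i
    simp [hp]
  · exact x.segment_congr (p := Omega.translate p (Omega.zero _))
      (q := Omega.translate p ⟨s, hs⟩) (by simp [Omega.translate, Omega.zero, hp])
      (by simp [Omega.translate, hp])

theorem shift_congr {x y : Λ.PathSpace} (hxy : x = y) (p : Omega x.d) (q : Omega y.d)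
    (h : p.1 = q.1) : x.shift p = y.shift q := by
  subst hxy
  obtain rfl := Subtype.ext h
  rfl

/-- A path is determined by an initial segment and the corresponding shift. -/
theorem eq_of_shift_eq {x y : Λ.PathSpace} {p : Omega x.d} {q : Omega y.d} (hpq : p.1 = q.1)
    (hinit : x.initSeg p.1 p.2 = y.initSeg q.1 q.2) (h : x.shift p = y.shift q) : x = y := by
  have hd : x.d = y.d := by
    funext i
    have h₁ : x.d i - (p.1 i : ℕ∞) = y.d i - (q.1 i : ℕ∞) := congrFun (congrArg PathSpace.d h) i
    rw [← tsub_add_cancel_of_le (p.2 i), ← tsub_add_cancel_of_le (q.2 i), h₁, hpq]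
  refine ext_init hd fun s hx hy => ?_
  -- Since `s` need not dominate `p`, the two paths are compared at degree s ⊔ p, where the shift
  -- controls them, and then cut back to `s`.
  have hs : ∀ i, (((s ⊔ p.1 - p.1) i : ℕ) : ℕ∞) ≤ (x.shift p).d i := by
    intro i
    change (((s i ⊔ p.1 i - p.1 i : ℕ)) : ℕ∞) ≤ x.d i - (p.1 i : ℕ∞)
    rw [ENat.natCast_sub]
    refine tsub_le_tsub_right ?_ _
    rcases max_choice (s i) (p.1 i) with h | h <;> rw [h]
    exacts [hx i, p.2 i]
  have h₁ := x.isComp_init_shift p _ hs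
  have h₂ := y.isComp_init_shift q (s ⊔ p.1 - p.1) (h ▸ hs)
  rw [hinit, init_congr h rfl hs (h ▸ hs)] at h₁
  have hle : s ≤ s ⊔ p.1 - p.1 + p.1 := le_tsub_add.trans' le_sup_left
  refine IsPrefix.eq Λ (x.isPrefix_init hx (le_d_add hs) hle) ?_
    ((x.pathDeg_init _ _).trans (y.pathDeg_init _ _).symm)
  rw [h₁.eq h₂]
  exact y.isPrefix_init hy _ (hpq ▸ hle)

/-- A compatible family of initial segments defines an element of the path space. -/
theorem exists_of_isPrefix (d : Fin k → ℕ∞) (P : Omega d → Path V)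
    (hdeg : ∀ p, Λ.pathDeg (P p) = p.1) (hP : ∀ p q, p ≤ q → IsPrefix (P p) (P q)) :
    ∃ x : Λ.PathSpace, ∃ hd : x.d = d, ∀ p hp, x.initSeg p hp = P ⟨p, hd ▸ hp⟩ := by
  -- The morphism x(p, q) is the quotient of `P q` by `P p`; its uniqueness gives functoriality.
  have key : ∀ p q : Omega d, p ≤ q → ∃ m : (P p).2.1 ⟶ (P q).2.1,
      IsComp (P p) ⟨_, _, m⟩ (P q) := by
    intro p q h
    obtain ⟨b, hb⟩ := hP p q h
    obtain ⟨m, rfl⟩ := hb.exists_hom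
    exact ⟨m, hb⟩
  choose m hm using key
  have huniq : ∀ {p q : Omega d} {f g : (P p).2.1 ⟶ (P q).2.1}, IsComp (P p) ⟨_, _, f⟩ (P q) →
      IsComp (P p) ⟨_, _, g⟩ (P q) → f = g := by
    intro p q f g hf hg
    simpa using (hf.unique Λ hg rfl).2
  refine ⟨⟨d, { obj := fun p => (P p).2.1
                map := fun f => m _ _ (leOfHom f)
                map_id := fun p => huniq (hm _ _ _) (isComp_id_right _)
                map_comp := ?_ }, ?_⟩, rfl, ?_⟩
  · intro p q s f g
    refine huniq (hm _ _ _) ?_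
    obtain ⟨e, he, he'⟩ := (hm p q (leOfHom f)).assoc (hm q s (leOfHom g))
    rwa [← he.eq (IsComp.mk _ _)]
  · intro p q f
    have h := (hm p q (leOfHom f)).deg_eq Λ
    rw [hdeg, hdeg] at h
    exact (tsub_eq_of_eq_add_rev h).symm
  · intro p hp
    exact (hm (Omega.zero d) ⟨p, hp⟩ (Omega.zero_le _)).right_eq_of_deg_left Λ (hdeg _)

/-- The concatenation `a y` of a finite path `a` with an element `y` of the path space. -/
theorem exists_concat (a : Path V) (y : Λ.PathSpace)
    (h : a.2.1 = y.toFunctor.obj (Omega.zero y.d)) :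
    ∃ (x : Λ.PathSpace) (hp : ∀ i, (Λ.pathDeg a i : ℕ∞) ≤ x.d i),
      x.initSeg (Λ.pathDeg a) hp = a ∧ x.shift ⟨Λ.pathDeg a, hp⟩ = y := by
  set n := Λ.pathDeg a
  let d : Fin k → ℕ∞ := fun i => y.d i + (n i : ℕ∞)
  have hle : ∀ (p : Omega d) i, (((p.1 ⊔ n - n) i : ℕ) : ℕ∞) ≤ y.d i := by
    intro p i
    change ((p.1 i ⊔ n i - n i : ℕ) : ℕ∞) ≤ y.d i
    rw [ENat.natCast_sub, tsub_le_iff_right]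
    rcases max_choice (p.1 i) (n i) with h | h <;> rw [h]
    exacts [p.2 i, le_add_self]
  have hc : ∀ q hq, ∃ c, IsComp a (y.initSeg q hq) c := fun q hq => exists_isComp_of_eq h
  -- Here `c q` is the path a y(0, q), of degree n + q.
  choose c hc using hc
  have hcdeg : ∀ q hq, Λ.pathDeg (c q hq) = n + q := by
    intro q hq
    rw [(hc q hq).deg_eq Λ, y.pathDeg_init]
  have hcpre : ∀ q hq q' hq', q ≤ q' → IsPrefix (c q hq) (c q' hq') := by
    intro q hq q' hq' hqq
    obtain ⟨b, hb⟩ := y.isPrefix_init hq hq' hqq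
    obtain ⟨e, he, he'⟩ := (hc q' hq').assoc_symm hb
    rw [(hc q hq).eq he]
    exact he'.isPrefix
  -- The initial segment of degree `p` is cut out of `c` at (p ⊔ n) - n, whose degree p ⊔ n is large
  -- enough even when `p` does not dominate `n`.
  have hP : ∀ p : Omega d, ∃ P, IsPrefix P (c _ (hle p)) ∧ Λ.pathDeg P = p.1 := by
    intro p
    have h₁ : Λ.pathDeg (c _ (hle p)) = p.1 + (p.1 ⊔ n - p.1) := by
      rw [hcdeg, add_tsub_cancel_of_le le_sup_right, add_tsub_cancel_of_le le_sup_left]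
    obtain ⟨P, b, hb, hd, -⟩ := Λ.exists_isComp _ _ _ h₁
    exact ⟨P, hb.isPrefix, hd⟩
  choose P hP hPdeg using hP
  obtain ⟨x, hd, hx⟩ := exists_of_isPrefix (Λ := Λ) d P hPdeg (by
    intro p q hpq
    refine ((hP p).trans (hcpre _ _ _ (hle q) ?_)).of_le Λ (hP q) ?_
    · exact tsub_le_tsub_right (sup_le_sup_right (show p.1 ≤ q.1 from hpq) n) n
    · rw [hPdeg, hPdeg]
      exact hpq)
  have hdi : ∀ i, x.d i = y.d i + (n i : ℕ∞) := fun i => congrFun hd i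
  have hp : ∀ i, (n i : ℕ∞) ≤ x.d i := fun i => (hdi i).symm ▸ le_add_self
  have hcc : ∀ q q' hq hq', q = q' → c q hq = c q' hq' := by
    rintro q _ hq hq' rfl
    rfl
  have hxc : ∀ s hs hs', x.initSeg (s + n) hs' = c s hs := by
    intro s hs hs'
    have h₁ : IsPrefix (x.initSeg (s + n) hs') (c s hs) := by
      rw [hx, ← hcc _ s (hle ⟨s + n, fun i => congrFun hd i ▸ hs' i⟩) hs]
      · exact hP _
      · change (s + n) ⊔ n - n = s
        rw [sup_eq_left.2 le_add_self, add_tsub_cancel_right]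
    exact h₁.eq Λ (isComp_id_right _).isPrefix (by rw [x.pathDeg_init, hcdeg, add_comm])
  have hinit : x.initSeg n hp = a := by
    have h₀ : ∀ i, (((0 + n : Fin k → ℕ) i : ℕ) : ℕ∞) ≤ x.d i := by simpa using hp
    refine (x.isPrefix_init hp h₀ (zero_add n).ge).eq Λ ?_ (x.pathDeg_init _ _)
    rw [hxc 0 (by simp) h₀]
    exact (hc _ _).isPrefix
  refine ⟨x, hp, hinit, ext_init ?_ fun s hs hs' => ?_⟩
  · funext i
    change x.d i - (n i : ℕ∞) = y.d i
    rw [hdi, (ENat.addLECancellable_of_ne_top (ENat.natCast_ne_top _)).add_tsub_cancel_right]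
  · have h₁ := x.isComp_init_shift ⟨n, hp⟩ s hs
    rw [hinit, hxc s hs'] at h₁
    exact (h₁.unique Λ (hc s hs') rfl).2

end PathSpace
end KGraph
namespace KGraph

/-! ### Measurability, bisections and the scaling of cylinder measures. -/

variable {k : ℕ} {V : Type u₁} [Category.{u₂} V] {Λ : KGraph k V}

theorem isOpen_cylinder {v w : V} (l : v ⟶ w) : IsOpen (Λ.cylinder l) :=
  TopologicalSpace.isOpen_generateFrom_of_mem ⟨v, w, l, ∅, by simp [cylinderDiff]⟩

theorem isOpen_bisection {v v' w : V} (l : v ⟶ w) (e : v' ⟶ w) : IsOpen (Λ.bisection l e) :=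
  TopologicalSpace.isOpen_generateFrom_of_mem ⟨v, v', w, l, e, ∅, by simp [bisectionDiff]⟩

theorem PathSpace.mem_cylinder_init (x : Λ.PathSpace) {p : Fin k → ℕ}
    (h : ∀ i, (p i : ℕ∞) ≤ x.d i) :
    x ∈ Λ.cylinder (x.initSeg p h).2.2 := by
  have hd : Λ.pathDeg (x.initSeg p h) = p := x.pathDeg_init p h
  have h' : ∀ i, (Λ.pathDeg (x.initSeg p h) i : ℕ∞) ≤ x.d i := by rwa [hd]
  exact ⟨h', PathSpace.init_congr rfl hd _ _⟩

theorem single_le_of_eq_top {x : Λ.PathSpace} {l : Fin k} (h : x.d l = ⊤) (n : ℕ) (i : Fin k) :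
    ((Pi.single l n : Fin k → ℕ) i : ℕ∞) ≤ x.d i := by
  rcases eq_or_ne i l with rfl | hi
  · simp [h]
  · simp [hi]

/-- An infinite `l`-th degree means having an initial segment of degree n e_l for every n, which is
a countable intersection of open sets. -/
theorem measurableSet_d_eq_top (l : Fin k) : MeasurableSet {x : Λ.PathSpace | x.d l = ⊤} := by
  have : {x : Λ.PathSpace | x.d l = ⊤} =
      ⋂ n : ℕ, ⋃ a : {a : Path V // Λ.pathDeg a = Pi.single l n}, Λ.cylinder a.1.2.2 := by
    ext x
    simp only [Set.mem_ofPred_eq, Set.mem_iInter, Set.mem_iUnion]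
    constructor
    · intro h n
      have hn := single_le_of_eq_top h n
      exact ⟨⟨x.initSeg _ hn, x.pathDeg_init _ hn⟩, x.mem_cylinder_init hn⟩
    · intro h
      refine ENat.eq_top_iff_forall_ge.2 fun n => ?_
      obtain ⟨⟨a, ha⟩, hx, -⟩ := h n
      have := hx l
      change (Λ.pathDeg a l : ℕ∞) ≤ _ at this
      simpa [ha] using this
  rw [this]
  exact MeasurableSet.iInter fun n =>
    (isOpen_iUnion fun a => isOpen_cylinder _).measurableSet

theorem mem_cylinder_id {x : Λ.PathSpace} {w : V} :
    x ∈ Λ.cylinder (𝟙 w) ↔ x.toFunctor.obj (Omega.zero x.d) = w := by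
  constructor
  · rintro ⟨h, h'⟩
    exact congrArg Sigma.fst h'
  · rintro rfl
    have h : ∀ i, ((Λ.deg (𝟙 (x.toFunctor.obj (Omega.zero x.d))) i : ℕ) : ℕ∞) ≤ x.d i := by
      simp [Λ.deg_id]
    have hp : IsPrefix (x.initSeg _ h) (x.initSeg _ h) := (isComp_id_right _).isPrefix
    exact ⟨h, (hp.eq Λ (isComp_id_left (x.initSeg _ h)).isPrefix (x.pathDeg_init _ h))⟩

/-- Prolonging both paths of a bisection by a segment of the common tail. -/
theorem mem_bisection_comp {g : Λ.PathGroupoid} {v v' w : V} {l : v ⟶ w} {e : v' ⟶ w}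
    (hg : g ∈ Λ.bisection l e) {p : Fin k → ℕ}
    (hp : ∀ i, ((p i + Λ.deg l i : ℕ) : ℕ∞) ≤ g.range.d i) :
    ∃ (z : V) (t : w ⟶ z), Λ.deg t = p ∧ g ∈ Λ.bisection (l ≫ t) (e ≫ t) := by
  obtain ⟨hlag, ⟨h₁, hl⟩, ⟨h₂, he⟩, h₃, h₄, hs⟩ := hg
  change g.range.shift ⟨Λ.deg l, h₁⟩ = g.source.shift ⟨Λ.deg e, h₂⟩ at hs
  have hpx : ∀ i, (p i : ℕ∞) ≤ (g.range.shift ⟨Λ.deg l, h₁⟩).d i := fun i =>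
    (ENat.addLECancellable_natCast _).le_tsub_of_add_le_right
      ((Nat.cast_add (R := ℕ∞) _ _).symm.trans_le (hp i))
  have hpy : ∀ i, (p i : ℕ∞) ≤ (g.source.shift ⟨Λ.deg e, h₂⟩).d i := hs ▸ hpx
  have hx := g.range.isComp_init_shift ⟨Λ.deg l, h₁⟩ p hpx
  have hy := g.source.isComp_init_shift ⟨Λ.deg e, h₂⟩ p hpy
  have hxy : (g.source.shift ⟨Λ.deg e, h₂⟩).initSeg p hpy =
      (g.range.shift ⟨Λ.deg l, h₁⟩).initSeg p hpx := PathSpace.init_congr hs.symm rfl _ _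
  change g.range.initSeg (Λ.deg l) h₁ = _ at hl
  change g.source.initSeg (Λ.deg e) h₂ = _ at he
  have hdeg := (g.range.shift ⟨Λ.deg l, h₁⟩).pathDeg_init p hpx
  rw [hxy] at hy
  -- By `hs` the same segment `b` extends both paths. Making it a variable allows its range to be
  -- identified with `w`.
  generalize (g.range.shift ⟨Λ.deg l, h₁⟩).initSeg p hpx = b at *
  have hbw : b.1 = w := by
    rw [hl] at hx
    obtain ⟨_, _, _, _, _, hh, rfl, -⟩ := hx
    exact (congrArg (fun a : Path V => a.2.1) hh).symm
  obtain ⟨w, z, t⟩ := b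
  obtain rfl : w = _ := hbw
  rw [hl] at hx
  rw [he] at hy
  have hdl : Λ.deg (l ≫ t) = p + Λ.deg l := by rw [Λ.deg_comp, add_comm, ← hdeg]; rfl
  have hde : Λ.deg (e ≫ t) = p + Λ.deg e := by rw [Λ.deg_comp, add_comm, ← hdeg]; rfl
  have hqx : ∀ i, (Λ.deg (l ≫ t) i : ℕ∞) ≤ g.range.d i := by
    rw [hdl]; exact PathSpace.le_d_add hpx
  have hqy : ∀ i, (Λ.deg (e ≫ t) i : ℕ∞) ≤ g.source.d i := by
    rw [hde]; exact PathSpace.le_d_add hpy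
  refine ⟨z, t, hdeg, ?_, ⟨hqx, ?_⟩, ⟨hqy, ?_⟩, hqx, hqy, ?_⟩
  · intro i
    rw [hlag, hdl, hde]
    simp
  · exact (PathSpace.init_congr rfl hdl _ _).trans (hx.eq (IsComp.mk l t))
  · exact (PathSpace.init_congr rfl hde _ _).trans (hy.eq (IsComp.mk e t))
  · have h₅ := PathSpace.shift_congr hs ⟨p, hpx⟩ ⟨p, hpy⟩ rfl
    rw [PathSpace.shift_shift, PathSpace.shift_shift] at h₅
    exact (PathSpace.shift_congr rfl _ _ hdl).trans
      (h₅.trans (PathSpace.shift_congr rfl _ _ hde.symm))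

/-- Inside the bisection, the `j`-th degree is infinite exactly when, for each n, the common tail
begins with some `t` of degree n e_j. This describes the set through open bisections alone, without
measurability of the range map. -/
theorem measurableSet_bisection_d_eq_top {v v' w : V} (l : v ⟶ w) (e : v' ⟶ w) (j : Fin k) :
    MeasurableSet {g | g ∈ Λ.bisection l e ∧ g.range.d j = ⊤} := by
  have : {g | g ∈ Λ.bisection l e ∧ g.range.d j = ⊤} = Λ.bisection l e ∩
      ⋂ n : ℕ, ⋃ t : {t : Σ z : V, (w ⟶ z) // Λ.deg t.2 = Pi.single j n},
        Λ.bisection (l ≫ t.1.2) (e ≫ t.1.2) := by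
    ext g
    simp only [Set.mem_ofPred_eq, Set.mem_inter_iff, Set.mem_iInter, Set.mem_iUnion]
    refine and_congr_right fun hg => ⟨fun h n => ?_, fun h => ?_⟩
    · obtain ⟨z, t, ht, hgt⟩ := mem_bisection_comp hg (p := Pi.single j n) (by
        intro i
        rcases eq_or_ne i j with rfl | hi
        · simp [h]
        · simpa [hi] using hg.2.1.1 i)
      exact ⟨⟨⟨z, t⟩, ht⟩, hgt⟩
    · refine ENat.eq_top_iff_forall_ge.2 fun n => ?_
      obtain ⟨⟨⟨z, t⟩, ht⟩, -, ⟨hx, -⟩, -⟩ := h n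
      have := hx j
      rw [Λ.deg_comp] at this
      refine le_trans ?_ this
      simp only at ht
      simp [ht]
  rw [this]
  exact (isOpen_bisection l e).measurableSet.inter (MeasurableSet.iInter fun n =>
    (isOpen_iUnion fun a => isOpen_bisection _ _).measurableSet)

theorem PathGroupoid.eq_of_range_lag_source {g h : Λ.PathGroupoid}
    (h₁ : g.range = h.range) (h₂ : g.lag = h.lag)
    (h₃ : g.source = h.source) : g = h := by
  obtain ⟨x, n, y, hg⟩ := g
  obtain ⟨x', n', y', hh⟩ := h
  obtain rfl : x = x' := h₁
  obtain rfl : n = n' := h₂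
  obtain rfl : y = y' := h₃
  rfl

/-- The elements of `Z(λ * s(λ))` are the triples `(x, d(λ), σ^{d(λ)}(x))` with `x ∈ Z(λ)`. -/
theorem mem_bisection_id {g : Λ.PathGroupoid} {v w : V} {l : v ⟶ w}
    (hg : g ∈ Λ.bisection l (𝟙 w)) :
    (∀ i, g.lag i = (Λ.deg l i : ℤ)) ∧ g.source ∈ Λ.cylinder (𝟙 w) ∧
      ∃ h, g.range.initSeg (Λ.deg l) h = ⟨v, w, l⟩ ∧ g.range.shift ⟨Λ.deg l, h⟩ = g.source := by
  obtain ⟨hlag, ⟨h₁, hl⟩, h₂, h₃, h₄, hs⟩ := hg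
  refine ⟨fun i => by rw [hlag]; simp [Λ.deg_id], h₂, h₁, hl, hs.trans ?_⟩
  exact PathSpace.shift_eq_self _ _ (Λ.deg_id w)

theorem exists_mem_bisection_id {v w : V} {l : v ⟶ w} {x y : Λ.PathSpace}
    (hp : ∀ i, (Λ.deg l i : ℕ∞) ≤ x.d i) (hinit : x.initSeg (Λ.deg l) hp = ⟨v, w, l⟩)
    (hs : x.shift ⟨Λ.deg l, hp⟩ = y) :
    ∃ g ∈ Λ.bisection l (𝟙 w), g.range = x ∧ g.source = y := by
  subst hs
  have h0 : ∀ i, (Λ.deg (𝟙 w) i : ℕ∞) ≤ (x.shift ⟨Λ.deg l, hp⟩).d i := by simp [Λ.deg_id]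
  have hs : x.shift ⟨Λ.deg l, hp⟩ = (x.shift ⟨Λ.deg l, hp⟩).shift ⟨Λ.deg (𝟙 w), h0⟩ :=
    (PathSpace.shift_eq_self _ _ (Λ.deg_id w)).symm
  refine ⟨⟨x, fun i => Λ.deg l i - Λ.deg (𝟙 w) i, _, ⟨Λ.deg l, hp⟩, ⟨Λ.deg (𝟙 w), h0⟩,
    fun i => rfl, hs⟩, ⟨fun i => rfl, ⟨hp, hinit⟩, ?_, hp, h0, hs⟩, rfl, rfl⟩
  rw [mem_cylinder_id]
  exact (congrArg x.toFunctor.obj (Subtype.ext (zero_add (Λ.deg l)))).trans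
    (congrArg (fun a : Path V => a.2.1) hinit)

/-- The restricted bisection maps injectively by range onto Z(l) ∩ S and by source onto Z(w) ∩ S,
and the cocycle is constantly r · d(l) on it. Both sides of quasi-invariance thus collapse to the
measures of these two sets. -/
theorem measure_cylinder_inter {μ : Measure Λ.PathSpace} {r : Fin k → ℝ}
    (hμ : Λ.IsQuasiInvariant μ (Λ.cocycle r)) {S : Set Λ.PathSpace} (hS : MeasurableSet S)
    (hinv : ∀ x p, PathSpace.shift x p ∈ S ↔ x ∈ S) {v w : V} (l : v ⟶ w)
    (hmeas : MeasurableSet {g | g ∈ Λ.bisection l (𝟙 w) ∧ g.range ∈ S}) :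
    μ (Λ.cylinder l ∩ S) =
      ENNReal.ofReal (Real.exp (-∑ i, r i * Λ.deg l i)) * μ (Λ.cylinder (𝟙 w) ∩ S) := by
  set U := {g | g ∈ Λ.bisection l (𝟙 w) ∧ g.range ∈ S}
  have h := hμ (U.indicator 1) (measurable_one.indicator hmeas)
  -- Over x in Z(l) ∩ S the only contribution is from (x, d(l), σ^{d(l)}(x)).
  have hL : ∀ x, ∑' g : {g : Λ.PathGroupoid // g.range = x},
      U.indicator (1 : Λ.PathGroupoid → ℝ≥0∞) g.1 =
      (Λ.cylinder l ∩ S).indicator 1 x := by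
    intro x
    by_cases hx : x ∈ Λ.cylinder l ∩ S
    · obtain ⟨⟨hp, hl⟩, hxS⟩ := hx
      obtain ⟨g, hg, hgx, hgy⟩ := exists_mem_bisection_id (y := x.shift _) hp hl rfl
      rw [Set.indicator_of_mem (show x ∈ Λ.cylinder l ∩ S from ⟨⟨hp, hl⟩, hxS⟩),
        tsum_eq_single ⟨g, hgx⟩,
        Set.indicator_of_mem (show g ∈ U from ⟨hg, by rwa [hgx]⟩)]
      · rfl
      · rintro ⟨g', hg'x⟩ hne
        refine Set.indicator_of_notMem (fun hg' => hne (Subtype.ext ?_)) _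
        obtain ⟨h₁, -, h₂, h₃, h₄⟩ := mem_bisection_id hg
        obtain ⟨h₁', -, h₂', h₃', h₄'⟩ := mem_bisection_id hg'.1
        refine PathGroupoid.eq_of_range_lag_source (hg'x.trans hgx.symm)
          (funext fun i => (h₁' i).trans (h₁ i).symm) (h₄'.symm.trans (Eq.trans ?_ h₄))
        exact PathSpace.shift_congr (hg'x.trans hgx.symm) _ _ rfl
    · rw [Set.indicator_of_notMem hx]
      refine ENNReal.tsum_eq_zero.2 ?_
      rintro ⟨g, rfl⟩
      exact Set.indicator_of_notMem (fun hg => hx ⟨hg.1.2.1, hg.2⟩) _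
  -- Over y in Z(w) ∩ S the only contribution is from (ly, d(l), y); shift invariance puts ly in S.
  have hR : ∀ y, ∑' g : {g : Λ.PathGroupoid // g.source = y},
      ENNReal.ofReal (Real.exp (-Λ.cocycle r g.1)) * U.indicator (1 : Λ.PathGroupoid → ℝ≥0∞) g.1 =
      (Λ.cylinder (𝟙 w) ∩ S).indicator
        (fun _ => ENNReal.ofReal (Real.exp (-∑ i, r i * Λ.deg l i))) y := by
    intro y
    by_cases hy : y ∈ Λ.cylinder (𝟙 w) ∩ S
    · obtain ⟨x, hp, hl, hs⟩ := PathSpace.exists_concat (⟨v, w, l⟩ : Path V) y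
        (mem_cylinder_id.1 hy.1).symm
      obtain ⟨g, hg, hgx, hgy⟩ := exists_mem_bisection_id hp hl hs
      have hxS : x ∈ S := by
        rw [← hinv x _, hs]
        exact hy.2
      rw [Set.indicator_of_mem hy, tsum_eq_single ⟨g, hgy⟩,
        Set.indicator_of_mem (show g ∈ U from ⟨hg, by rwa [hgx]⟩)]
      · simp [cocycle, (mem_bisection_id hg).1]
      · rintro ⟨g', hg'y⟩ hne
        refine mul_eq_zero_of_right _
          (Set.indicator_of_notMem (fun hg' => hne (Subtype.ext ?_)) _)
        obtain ⟨h₁, -, h₂, h₃, h₄⟩ := mem_bisection_id hg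
        obtain ⟨h₁', -, h₂', h₃', h₄'⟩ := mem_bisection_id hg'.1
        exact PathGroupoid.eq_of_range_lag_source
          (PathSpace.eq_of_shift_eq (p := ⟨_, h₂'⟩) (q := ⟨_, h₂⟩) rfl
          (h₃'.trans h₃.symm) (h₄'.trans ((hg'y.trans hgy.symm).trans h₄.symm)))
          (funext fun i => (h₁' i).trans (h₁ i).symm) (hg'y.trans hgy.symm)
    · rw [Set.indicator_of_notMem hy]
      refine ENNReal.tsum_eq_zero.2 ?_
      rintro ⟨g, rfl⟩
      refine mul_eq_zero_of_right _ (Set.indicator_of_notMem (fun hg => hy ?_) _)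
      obtain ⟨-, h₂, h₃, -, h₄⟩ := mem_bisection_id hg.1
      exact ⟨h₂, by rw [← h₄, hinv]; exact hg.2⟩
  simp only [hL, hR] at h
  rwa [lintegral_indicator_one ((isOpen_cylinder l).measurableSet.inter hS),
    lintegral_indicator_const ((isOpen_cylinder _).measurableSet.inter hS)] at h

end KGraph
-- Spectral radius bounds from subinvariant vectors and eigenvectors.
section SpectralRadius

variable {V : Type*} [Fintype V] [DecidableEq V]

/-- A nonnegative matrix with a positive vector `x` such that `A x ≤ t x` has spectral radius
at most `t`. -/
theorem spectralRadius_le_of_mulVec_le (A : Matrix V V ℕ) {x : V → ℝ} {t : ℝ}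
    (hx : ∀ v, 0 < x v) (h : ∀ v, ∑ w, (A v w : ℝ) * x w ≤ t * x v) :
    spectralRadius ℂ (A.map (fun a : ℕ => (a : ℂ))) ≤ ENNReal.ofReal t := by
  refine iSup₂_le fun z hz => ?_
  rw [← Matrix.spectrum_toLin', ← Module.End.hasEigenvalue_iff_mem_spectrum] at hz
  obtain ⟨f, hf⟩ := hz.exists_hasEigenvector
  have hf' : ∀ v, ∑ w, (A v w : ℂ) * f w = z * f v := fun v => by
    simpa [Matrix.mulVec, dotProduct] using congrFun hf.apply_eq_smul v
  obtain ⟨u, hu⟩ := Function.ne_iff.1 hf.2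
  -- The eigenvector equation is evaluated where `f` attains its sup norm weighted by `x`; there
  -- subinvariance gives ‖z‖ ≤ t.
  obtain ⟨v, -, hv⟩ := Finset.exists_max_image Finset.univ (fun v => ‖f v‖ / x v)
    ⟨u, Finset.mem_univ u⟩
  set M := ‖f v‖ / x v
  have hMpos : 0 < M := (div_pos (norm_pos_iff.2 hu) (hx u)).trans_le (hv u (Finset.mem_univ u))
  have hle : ∀ w, ‖f w‖ ≤ M * x w := fun w => (div_le_iff₀ (hx w)).1 (hv w (Finset.mem_univ w))
  have hfv : ‖f v‖ = M * x v := (div_mul_cancel₀ _ (hx v).ne').symm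
  have key : ‖z‖ * (M * x v) ≤ t * (M * x v) := by
    calc ‖z‖ * (M * x v) = ‖∑ w, (A v w : ℂ) * f w‖ := by rw [hf', norm_mul, hfv]
      _ ≤ ∑ w, (A v w : ℝ) * (M * x w) := by
        refine norm_sum_le_of_le _ fun w _ => ?_
        rw [norm_mul, Complex.norm_natCast]
        exact mul_le_mul_of_nonneg_left (hle w) (Nat.cast_nonneg _)
      _ = M * ∑ w, (A v w : ℝ) * x w := by
        rw [Finset.mul_sum]
        exact Finset.sum_congr rfl fun w _ => by ring
      _ ≤ M * (t * x v) := mul_le_mul_of_nonneg_left (h v) hMpos.le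
      _ = t * (M * x v) := by ring
  rw [← enorm_eq_nnnorm, ← ofReal_norm]
  exact ENNReal.ofReal_le_ofReal (le_of_mul_le_mul_right key (mul_pos hMpos (hx v)))

/-- Viewed over ℂ, `x` is an eigenvector, so `t` lies in the spectrum; as `t` is nonnegative, it
equals its modulus. -/
theorem le_spectralRadius_of_mulVec_eq (A : Matrix V V ℕ) {x : V → ℝ} {t : ℝ} (ht : 0 ≤ t)
    (hx : x ≠ 0) (h : ∀ v, ∑ w, (A v w : ℝ) * x w = t * x v) :
    ENNReal.ofReal t ≤ spectralRadius ℂ (A.map (fun a : ℕ => (a : ℂ))) := by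
  have hev : Module.End.HasEigenvalue
      (Matrix.toLin' (A.map (fun a : ℕ => (a : ℂ)))) (t : ℂ) := by
    refine Module.End.hasEigenvalue_of_hasEigenvector (x := fun v => (x v : ℂ)) ⟨?_, ?_⟩
    · rw [Module.End.mem_eigenspace_iff]
      funext v
      have := congrArg (fun a : ℝ => (a : ℂ)) (h v)
      simpa [Matrix.mulVec, dotProduct] using this
    · intro h0
      exact hx (funext fun v => by simpa using congrFun h0 v)
  have hmem : (t : ℂ) ∈ spectrum ℂ (A.map (fun a : ℕ => (a : ℂ))) := by
    rw [← Matrix.spectrum_toLin']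
    exact hev.mem_spectrum
  refine le_trans ?_ (le_iSup₂ (f := fun (z : ℂ) (_ : z ∈ spectrum ℂ _) => (‖z‖₊ : ℝ≥0∞)) _ hmem)
  rw [ENNReal.ofReal]
  exact ENNReal.coe_le_coe.2 (by rw [← NNReal.coe_le_coe]; simp [ht, abs_of_nonneg])

/-- If `A` is irreducible and `A x ≤ t x` with `x ≥ 0` nonzero, then `x` is positive. -/
theorem pos_of_mulVec_le (A : Matrix V V ℕ) (hA : ∀ v w, ∃ n : ℕ, (A ^ n) v w ≠ 0) {x : V → ℝ}
    {t : ℝ} (ht : 0 < t) (hx : ∀ v, 0 ≤ x v) (h : ∀ v, ∑ w, (A v w : ℝ) * x w ≤ t * x v)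
    {u : V} (hu : 0 < x u) (v : V) : 0 < x v := by
  -- Iterating gives A^n x ≤ t^n x; choosing n with A^n(v, u) ≠ 0 then carries positivity from `u`
  -- to `v`.
  have hn : ∀ (n : ℕ) v, ∑ w, ((A ^ n) v w : ℝ) * x w ≤ t ^ n * x v := by
    intro n
    induction n with
    | zero => simp [Matrix.one_apply]
    | succ n ih =>
      intro v
      calc ∑ w, ((A ^ (n + 1)) v w : ℝ) * x w
          = ∑ y, (A v y : ℝ) * ∑ w, ((A ^ n) y w : ℝ) * x w := by
            simp only [pow_succ', Matrix.mul_apply, Nat.cast_sum, Nat.cast_mul, Finset.sum_mul,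
              Finset.mul_sum, mul_assoc]
            exact Finset.sum_comm
        _ ≤ ∑ y, (A v y : ℝ) * (t ^ n * x y) :=
            Finset.sum_le_sum fun y _ => mul_le_mul_of_nonneg_left (ih y) (Nat.cast_nonneg _)
        _ = t ^ n * ∑ y, (A v y : ℝ) * x y := by
            rw [Finset.mul_sum]
            exact Finset.sum_congr rfl fun w _ => by ring
        _ ≤ t ^ n * (t * x v) := mul_le_mul_of_nonneg_left (h v) (pow_pos ht n).le
        _ = t ^ (n + 1) * x v := by ring
  obtain ⟨n, hne⟩ := hA v u
  refine pos_of_mul_pos_right (b := x v) (a := t ^ n) ?_ (pow_pos ht n).le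
  refine lt_of_lt_of_le ?_ ((Finset.single_le_sum (f := fun w => ((A ^ n) v w : ℝ) * x w)
    (fun w _ => mul_nonneg (Nat.cast_nonneg _) (hx w)) (Finset.mem_univ u)).trans (hn n v))
  exact mul_pos (Nat.cast_pos.2 (Nat.pos_of_ne_zero hne)) hu

end SpectralRadius

/-! ### Vertex masses and the vertex matrices. -/

namespace KGraph

variable {k : ℕ} {V : Type u₁} [Category.{u₂} V] {Λ : KGraph k V}

theorem IsFinite.finite_hom (hfin : Λ.IsFinite) (n : Fin k → ℕ) (v w : V) :
    Finite {l : v ⟶ w // Λ.deg l = n} := by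
  have := (hfin n).to_subtype
  refine Finite.of_injective (β := {l : Path V | Λ.deg l.2.2 = n})
    (fun l => ⟨⟨v, w, l.1⟩, l.2⟩) fun l l' h => ?_
  simpa [Subtype.ext_iff] using h

/-- The paths of degree `e_i` with range `v`. -/
abbrev Edge (Λ : KGraph k V) (i : Fin k) (v : V) :=
  Σ w : V, {l : v ⟶ w // Λ.deg l = Pi.single i 1}

/-- A path has only one initial segment of degree e_i. -/
theorem disjoint_cylinder {i : Fin k} {v : V} {a b : Edge Λ i v} (hab : a ≠ b) :
    Disjoint (Λ.cylinder a.2.1) (Λ.cylinder b.2.1) := by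
  rw [Set.disjoint_left]
  rintro x ⟨h₁, ha⟩ ⟨h₂, hb⟩
  refine hab ?_
  obtain ⟨w, l, hl⟩ := a
  obtain ⟨w', l', hl'⟩ := b
  change x.initSeg (Λ.deg l) h₁ = _ at ha
  change x.initSeg (Λ.deg l') h₂ = _ at hb
  have : (⟨v, w, l⟩ : Path V) = ⟨v, w', l'⟩ := by
    rw [← ha, ← hb]
    congr 1
    exact hl.trans hl'.symm
  cases this
  rfl

theorem cylinder_subset_cylinder_id {v w : V} (l : v ⟶ w) :
    Λ.cylinder l ⊆ Λ.cylinder (𝟙 v) := by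
  rintro x ⟨h, hx⟩
  exact mem_cylinder_id.2 (congrArg Sigma.fst hx)

theorem exists_edge_of_mem {i : Fin k} {v : V} {x : Λ.PathSpace} (hx : x ∈ Λ.cylinder (𝟙 v))
    (hd : x.d i = ⊤) : ∃ a : Edge Λ i v, x ∈ Λ.cylinder a.2.1 := by
  have h := single_le_of_eq_top hd 1
  have h₁ := x.mem_cylinder_init h
  have h₂ := x.pathDeg_init _ h
  have h₃ : (x.initSeg _ h).1 = v := mem_cylinder_id.1 hx
  generalize x.initSeg _ h = b at *
  obtain ⟨v', w, l⟩ := b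
  obtain rfl : v' = v := h₃
  exact ⟨⟨w, l, h₂⟩, h₁⟩

variable [Fintype V]

/-- The total mass of the sets `Z(λ) ∩ S`, where `λ` runs through the edges of degree `e_i` with
range `v`. -/
theorem measure_iUnion_edge (hfin : Λ.IsFinite) {μ : Measure Λ.PathSpace} [IsFiniteMeasure μ]
    {r : Fin k → ℝ} (hμ : Λ.IsQuasiInvariant μ (Λ.cocycle r)) {S : Set Λ.PathSpace}
    (hS : MeasurableSet S) (hinv : ∀ x p, PathSpace.shift x p ∈ S ↔ x ∈ S)
    (hmeas : ∀ {v w : V} (l : v ⟶ w),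
      MeasurableSet {g | g ∈ Λ.bisection l (𝟙 w) ∧ g.range ∈ S}) (i : Fin k) (v : V) :
    ∑ w, (Λ.vertexMatrix i v w : ℝ) * μ.real (Λ.cylinder (𝟙 w) ∩ S) =
      Real.exp (r i) * μ.real (⋃ a : Edge Λ i v, Λ.cylinder a.2.1 ∩ S) := by
  have := hfin.finite_hom (Pi.single i 1) v
  have hE : ∀ w, Fintype {l : v ⟶ w // Λ.deg l = Pi.single i 1} := fun w => Fintype.ofFinite _
  have hcyl : ∀ a : Edge Λ i v, μ.real (Λ.cylinder a.2.1 ∩ S) =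
      Real.exp (-r i) * μ.real (Λ.cylinder (𝟙 a.1) ∩ S) := by
    rintro ⟨w, l, hl⟩
    rw [Measure.real, measure_cylinder_inter hμ hS hinv l (hmeas l), ENNReal.toReal_mul,
      ENNReal.toReal_ofReal (Real.exp_pos _).le]
    simp [hl, Pi.single_apply, Measure.real]
  -- By disjointness the union has the sum of the masses; the factor e^{r_i} cancels e^{-r_i}, and
  -- grouping edges by source produces the matrix entries.
  rw [measureReal_iUnion_fintype]
  · simp only [hcyl]
    rw [← Finset.mul_sum, ← mul_assoc, ← Real.exp_add, add_neg_cancel, Real.exp_zero, one_mul,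
      Fintype.sum_sigma]
    refine Finset.sum_congr rfl fun w _ => ?_
    simp [vertexMatrix]
  · intro a b hab
    exact (disjoint_cylinder hab).mono Set.inter_subset_left Set.inter_subset_left
  · exact fun a => (isOpen_cylinder _).measurableSet.inter hS

theorem exists_measureReal_pos {μ : Measure Λ.PathSpace} [IsFiniteMeasure μ] {S : Set Λ.PathSpace}
    (h : μ S ≠ 0) : ∃ v, 0 < μ.real (Λ.cylinder (𝟙 v) ∩ S) := by
  by_contra! hc
  refine h (measure_mono_null (t := ⋃ v, Λ.cylinder (𝟙 v) ∩ S) ?_ (measure_iUnion_null fun v => ?_))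
  · intro x hx
    exact Set.mem_iUnion.2 ⟨_, mem_cylinder_id.2 rfl, hx⟩
  · exact (measureReal_eq_zero_iff).1 (le_antisymm (hc v) measureReal_nonneg)

variable [DecidableEq V]

theorem rho_le_ofReal_exp (hfin : Λ.IsFinite) (hirr : Λ.CoordinatewiseIrreducible) {r : Fin k → ℝ}
    {μ : Measure Λ.PathSpace} [IsProbabilityMeasure μ]
    (hμ : Λ.IsQuasiInvariant μ (Λ.cocycle r)) (i : Fin k) :
    Λ.rho i ≤ ENNReal.ofReal (Real.exp (r i)) := by
  have hle : ∀ v, ∑ w, (Λ.vertexMatrix i v w : ℝ) * μ.real (Λ.cylinder (𝟙 w) ∩ Set.univ) ≤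
      Real.exp (r i) * μ.real (Λ.cylinder (𝟙 v) ∩ Set.univ) := by
    intro v
    rw [measure_iUnion_edge hfin hμ MeasurableSet.univ (by simp)
      (fun l => by simpa using (isOpen_bisection l _).measurableSet)]
    refine mul_le_mul_of_nonneg_left (measureReal_mono ?_) (Real.exp_pos _).le
    exact Set.iUnion_subset fun a =>
      Set.inter_subset_inter_left _ (cylinder_subset_cylinder_id a.2.1)
  obtain ⟨u, hu⟩ := exists_measureReal_pos (μ := μ) (S := Set.univ) (by simp)
  exact spectralRadius_le_of_mulVec_le _ (pos_of_mulVec_le _ (hirr i) (Real.exp_pos _)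
    (fun v => measureReal_nonneg) hle hu) hle

theorem ofReal_exp_le_rho (hfin : Λ.IsFinite) {r : Fin k → ℝ}
    {μ : Measure Λ.PathSpace} [IsProbabilityMeasure μ]
    (hμ : Λ.IsQuasiInvariant μ (Λ.cocycle r)) (j : Fin k) (hj : μ {x | x.d j = ⊤} ≠ 0) :
    ENNReal.ofReal (Real.exp (r j)) ≤ Λ.rho j := by
  obtain ⟨u, hu⟩ := exists_measureReal_pos hj
  refine le_spectralRadius_of_mulVec_eq _ (Real.exp_pos _).le
    (x := fun v => μ.real (Λ.cylinder (𝟙 v) ∩ {x | x.d j = ⊤}))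
    (fun h0 => hu.ne' (congrFun h0 u)) fun v => ?_
  rw [measure_iUnion_edge hfin hμ (measurableSet_d_eq_top j)
    -- Shift invariance holds because subtracting a natural number from ∞ leaves ∞ and cannot create
    -- it.
    (fun x p => by
      change x.d j - (p.1 j : ℕ∞) = ⊤ ↔ x.d j = ⊤
      simp [ENat.sub_eq_top_iff])
    (fun l => measurableSet_bisection_d_eq_top l _ j)]
  -- What remains is that the edge cylinders exhaust Z(v) ∩ S; this turns subinvariance into an
  -- eigenvector equation.
  congr 2
  refine Set.Subset.antisymm (Set.iUnion_subset fun a =>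
      Set.inter_subset_inter_left _ (cylinder_subset_cylinder_id a.2.1)) fun x hx => ?_
  obtain ⟨a, ha⟩ := exists_edge_of_mem hx.1 hx.2
  exact Set.mem_iUnion.2 ⟨a, ha, hx.2⟩

end KGraph

theorem lemmaB2 {k : ℕ} {V : Type u₁} [Category.{u₂} V] [Fintype V] [DecidableEq V]
    (Λ : KGraph k V) (hfin : Λ.IsFinite) (hirr : Λ.CoordinatewiseIrreducible)
    (r : Fin k → ℝ) (hr : ∀ i, 0 < r i)
    (μ : Measure Λ.PathSpace) [IsProbabilityMeasure μ]
    (hμ : Λ.IsQuasiInvariant μ (Λ.cocycle r)) :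
    (∀ i, ENNReal.log (Λ.rho i) ≤ ((r i : ℝ) : EReal)) ∧
    (∀ l, μ {x | x.d l = ⊤} ≠ 0 → ((r l : ℝ) : EReal) = ENNReal.log (Λ.rho l)) ∧
    (μ {x | ∀ l, x.d l = ⊤} ≠ 0 → ∀ l, ((r l : ℝ) : EReal) = ENNReal.log (Λ.rho l)) := by

  have hlog : ∀ t : ℝ, ENNReal.log (ENNReal.ofReal (Real.exp t)) = (t : EReal) := fun t => by
    rw [ENNReal.log_ofReal_of_pos (Real.exp_pos t), Real.log_exp]
  have hle : ∀ i, ENNReal.log (Λ.rho i) ≤ ((r i : ℝ) : EReal) := fun i => by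
    rw [← hlog]
    exact ENNReal.log_monotone (KGraph.rho_le_ofReal_exp hfin hirr hμ i)
  have heq : ∀ l, μ {x | x.d l = ⊤} ≠ 0 → ((r l : ℝ) : EReal) = ENNReal.log (Λ.rho l) := by
    intro l hl
    refine le_antisymm ?_ (hle l)
    rw [← hlog]
    exact ENNReal.log_monotone (KGraph.ofReal_exp_le_rho hfin hμ l hl)
  exact ⟨hle, heq, fun h l => heq l fun h0 => h (measure_mono_null (fun x hx => hx l) h0)⟩
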